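/- Let $X$ be an Archimedean (real) vector lattice, let $X^{\delta}$ be its order completion and $X^{u}$ the universal completion of $X^{\delta}$ (equivalently, of $X$), and regard $X\subseteq X^{\delta}\subseteq X^{u}$. Let $X_{s}$ be the sup-completion of $X^{\delta}$ in the sense of Donner: the unique (up to isomorphism) order complete cone with a largest element that contains $X^{\delta}$ as its set of invertible elements, in which every element $y$ is the supremum of $\{z\in X^{\delta}: z\le y\}$ and every element below an element of $X^{\delta}$ lies in $X^{\delta}$, and in which $x+(f\wedge y)=(x+f)\wedge(x+y)$ for $x,y\in X_s$, $f\in X^\delta$, and $m\wedge z=\sup_{a\in A}(a\wedge z)$ whenever $m=\sup A$, $\emptyset\neq A\subseteq X_s$, $z\in X^\delta$. An element $x\in X_{s}$ and an element $u\in X^{u}$ are identified if $\{z\in X^{\delta}: z\le x\}=\{z\in X^{\delta}: z\le u\}$. If $x\in X_{s}\setminus X^{u}$ and $x\ge 0$, then there exists $a\in X$ such that $x\ge ta>0$ for all real $t>0$. -/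

import Mathlib

open scoped NNReal

/-! A (real) vector lattice is an additive commutative group with a lattice order and a real vector
space structure such that addition and multiplication by non-negative reals are monotone:
`[AddCommGroup X] [Lattice X] [IsOrderedAddMonoid X] [Module ℝ X] [IsOrderedModule ℝ X]`. -/

/-- Order completeness (Dedekind completeness): every non-empty set that is bounded above has a
supremum. -/
def IsOrderComplete (X : Type*) [Lattice X] : Prop :=
  ∀ s : Set X, s.Nonempty → BddAbove s → ∃ b, IsLUB s b

/-- Lateral completeness: every non-empty set of pairwise disjoint positive elements has a
supremum. -/
def IsLaterallyComplete (X : Type*) [AddCommGroup X] [Lattice X] : Prop :=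
  ∀ s : Set X, s.Nonempty → (∀ a ∈ s, 0 ≤ a) → (s.Pairwise fun a b => a ⊓ b = 0) →
    ∃ b, IsLUB s b

/-- `f` identifies `X` with an order dense vector sublattice of `Y`: it is an injective linear
lattice homomorphism, and below every `y > 0` in `Y` there is an element `0 < f x ≤ y`. -/
structure IsOrderDenseEmbedding {X Y : Type*} [AddCommGroup X] [Lattice X] [Module ℝ X]
    [AddCommGroup Y] [Lattice Y] [Module ℝ Y] (f : X →ₗ[ℝ] Y) : Prop where
  injective : Function.Injective f
  map_sup : ∀ a b, f (a ⊔ b) = f a ⊔ f b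
  map_inf : ∀ a b, f (a ⊓ b) = f a ⊓ f b
  dense : ∀ y, 0 < y → ∃ x, 0 < x ∧ f x ≤ y

/-- `f : X → Y` is the order completion (Dedekind completion) of the vector lattice `X`: the vector
lattice `Y` is order complete and `X` is an order dense and majorizing vector sublattice of it. -/
structure IsOrderCompletion {X Y : Type*} [AddCommGroup X] [Lattice X] [Module ℝ X]
    [AddCommGroup Y] [Lattice Y] [Module ℝ Y] (f : X →ₗ[ℝ] Y) : Prop
    extends IsOrderDenseEmbedding f where
  orderComplete : IsOrderComplete Y
  majorizing : ∀ y, ∃ x, y ≤ f x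

/-- `f : X → Y` is the universal completion of the vector lattice `X`: the vector lattice `Y` is
universally complete (order complete and laterally complete) and `X` is an order dense vector
sublattice of it. -/
structure IsUniversalCompletion {X Y : Type*} [AddCommGroup X] [Lattice X] [Module ℝ X]
    [AddCommGroup Y] [Lattice Y] [Module ℝ Y] (f : X →ₗ[ℝ] Y) : Prop
    extends IsOrderDenseEmbedding f where
  orderComplete : IsOrderComplete Y
  laterallyComplete : IsLaterallyComplete Y

/-- The sup-completion `X_s` of an order complete vector lattice `X`. An element `s` of `X_s` is
determined by the set `{y ∈ X | y ≤ s}`, and the sets that occur are the non-empty sets `A` which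
contain every `y ∈ X` with `y = sup {y ⊓ a | a ∈ A}` (in particular every `y` below an element of
`A`). Such a set is the canonical representative of its class in Donner's construction, where two
non-empty sets `A`, `B` are identified if `sup {x ⊓ a | a ∈ A} = sup {x ⊓ b | b ∈ B}` for all
`x ∈ X`. -/
@[ext]
structure SupCompletion (X : Type*) [Lattice X] where
  carrier : Set X
  nonempty' : carrier.Nonempty
  closed' : ∀ y, IsLUB ((fun a => y ⊓ a) '' carrier) y → y ∈ carrier

namespace SupCompletion

section Order

variable {X : Type*} [Lattice X]

/-- The order of `X_s`: inclusion of the sets of elements of `X` below. -/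
instance : PartialOrder (SupCompletion X) :=
  PartialOrder.lift carrier fun _ _ h => SupCompletion.ext h

theorem le_def {x y : SupCompletion X} : x ≤ y ↔ x.carrier ⊆ y.carrier := Iff.rfl

theorem mem_of_le (x : SupCompletion X) {y a : X} (ha : a ∈ x.carrier) (h : y ≤ a) :
    y ∈ x.carrier := by
  refine x.closed' y ⟨?_, fun u hu => ?_⟩
  · rintro _ ⟨b, -, rfl⟩; exact inf_le_left
  · have := hu ⟨a, ha, rfl⟩
    simpa [inf_eq_left.2 h] using this

/-- The inclusion of `X` in `X_s`. -/
def of (a : X) : SupCompletion X where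
  carrier := Set.Iic a
  nonempty' := ⟨a, le_refl a⟩
  closed' y hy := hy.2 (by rintro _ ⟨b, hb, rfl⟩; exact inf_le_right.trans hb)

theorem of_le_iff {a : X} {x : SupCompletion X} : of a ≤ x ↔ a ∈ x.carrier :=
  ⟨fun h => h (le_refl a), fun h _ hb => x.mem_of_le h hb⟩

theorem of_le_of {a b : X} : of a ≤ of b ↔ a ≤ b := of_le_iff

theorem of_injective : Function.Injective (of : X → SupCompletion X) := fun _ _ h =>
  le_antisymm (of_le_of.1 h.le) (of_le_of.1 h.ge)

/-- Every element of `X_s` is the supremum of the elements of `X` below it. -/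
theorem isLUB_of (x : SupCompletion X) : IsLUB (of '' {a | of a ≤ x}) x := by
  refine ⟨?_, fun z hz a ha => of_le_iff.1 (hz ⟨a, of_le_iff.2 ha, rfl⟩)⟩
  rintro _ ⟨a, ha, rfl⟩; exact ha

theorem sup_mem (x : SupCompletion X) {a b : X} (ha : a ∈ x.carrier) (hb : b ∈ x.carrier) :
    a ⊔ b ∈ x.carrier := by
  refine x.closed' _ ⟨?_, fun u hu => sup_le ?_ ?_⟩
  · rintro _ ⟨b, -, rfl⟩; exact inf_le_left
  · simpa using hu ⟨a, ha, rfl⟩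
  · simpa using hu ⟨b, hb, rfl⟩

/-- The infimum of two elements of `X_s`. -/
instance : SemilatticeInf (SupCompletion X) where
  inf x y :=
    { carrier := x.carrier ∩ y.carrier
      nonempty' := by
        obtain ⟨a, ha⟩ := x.nonempty'
        obtain ⟨b, hb⟩ := y.nonempty'
        exact ⟨a ⊓ b, x.mem_of_le ha inf_le_left, y.mem_of_le hb inf_le_right⟩
      closed' := fun z hz => by
        constructor
        · refine x.closed' z ⟨?_, fun u hu => hz.2 ?_⟩
          · rintro _ ⟨b, -, rfl⟩; exact inf_le_left
          · rintro _ ⟨b, hb, rfl⟩; exact hu ⟨b, hb.1, rfl⟩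
        · refine y.closed' z ⟨?_, fun u hu => hz.2 ?_⟩
          · rintro _ ⟨b, -, rfl⟩; exact inf_le_left
          · rintro _ ⟨b, hb, rfl⟩; exact hu ⟨b, hb.2, rfl⟩ }
  inf_le_left _ _ := Set.inter_subset_left
  inf_le_right _ _ := Set.inter_subset_right
  le_inf _ _ _ h h' := Set.subset_inter h h'

/-- The largest element of `X_s`. -/
instance [Nonempty X] : OrderTop (SupCompletion X) where
  top := ⟨Set.univ, Set.univ_nonempty, fun _ _ => Set.mem_univ _⟩
  le_top _ := Set.subset_univ _

/-- In an order complete lattice, an element of `X_s` that is below an element of `X` is in `X`. -/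
theorem exists_eq_of_of_le (hX : IsOrderComplete X) {x : SupCompletion X} {b : X} (h : x ≤ of b) :
    ∃ a, x = of a := by
  obtain ⟨a, ha⟩ := hX x.carrier x.nonempty' ⟨b, fun c hc => h hc⟩
  have hax : a ∈ x.carrier := by
    refine x.closed' a ⟨?_, fun u hu => ha.2 fun c hc => ?_⟩
    · rintro _ ⟨b, -, rfl⟩; exact inf_le_left
    · have := hu ⟨c, hc, rfl⟩
      simpa [inf_eq_right.2 (ha.1 hc)] using this
  exact ⟨a, le_antisymm (fun c hc => ha.1 hc) (of_le_iff.2 hax)⟩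

end Order

section Cone

variable {X : Type*} [AddCommGroup X] [Lattice X] [IsOrderedAddMonoid X]

theorem inf_le_of_isLUB {s : Set X} {d y u : X} (hd : IsLUB s d) (h : ∀ a ∈ s, y ⊓ a ≤ u) :
    y ⊓ d ≤ u := by
  have key : d ≤ u + y ⊔ d - y := hd.2 fun a ha => by
    have h1 : y ⊓ a + y ⊔ a = y + a := inf_add_sup y a
    have h2 : y ⊓ a + y ⊔ a ≤ u + y ⊔ d :=
      add_le_add (h a ha) (sup_le_sup_left (hd.1 ha) y)
    rw [h1] at h2
    exact le_sub_iff_add_le'.2 h2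
  have h1 : y ⊓ d + y ⊔ d = y + d := inf_add_sup y d
  have h2 : y + d ≤ u + y ⊔ d := le_sub_iff_add_le'.1 key
  rw [← h1] at h2
  exact le_of_add_le_add_right h2

/-- The supremum in `X_s` of a non-empty subset `s` of `X`. -/
def sup (s : Set X) (hs : s.Nonempty) : SupCompletion X where
  carrier := {y | IsLUB ((fun a => y ⊓ a) '' s) y}
  nonempty' := by
    obtain ⟨a, ha⟩ := hs
    refine ⟨a, ?_, fun u hu => by simpa using hu ⟨a, ha, rfl⟩⟩
    rintro _ ⟨b, -, rfl⟩; exact inf_le_left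
  closed' y hy := by
    refine ⟨?_, fun u hu => hy.2 ?_⟩
    · rintro _ ⟨b, -, rfl⟩; exact inf_le_left
    · rintro _ ⟨d, hd, rfl⟩
      refine inf_le_of_isLUB hd ?_
      rintro _ ⟨a, ha, rfl⟩
      exact (inf_le_inf_left y inf_le_right).trans (hu ⟨a, ha, rfl⟩)

theorem mem_sup_of_mem {s : Set X} {hs : s.Nonempty} {a : X} (ha : a ∈ s) :
    a ∈ (sup s hs).carrier := by
  refine ⟨?_, fun u hu => by simpa using hu ⟨a, ha, rfl⟩⟩
  rintro _ ⟨b, -, rfl⟩; exact inf_le_left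

theorem sup_le_iff {s : Set X} {hs : s.Nonempty} {x : SupCompletion X} :
    sup s hs ≤ x ↔ s ⊆ x.carrier := by
  refine ⟨fun h a ha => h (mem_sup_of_mem ha), fun h y hy => x.closed' y ⟨?_, fun u hu => hy.2 ?_⟩⟩
  · rintro _ ⟨b, -, rfl⟩; exact inf_le_left
  · rintro _ ⟨a, ha, rfl⟩; exact hu ⟨a, h ha, rfl⟩

/-- Every non-empty subset of `X_s` has a supremum. -/
theorem exists_isLUB (s : Set (SupCompletion X)) (hs : s.Nonempty) : ∃ z, IsLUB s z := by
  have hne : (⋃ x ∈ s, x.carrier).Nonempty := by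
    obtain ⟨x, hx⟩ := hs
    obtain ⟨a, ha⟩ := x.nonempty'
    exact ⟨a, Set.mem_biUnion hx ha⟩
  refine ⟨sup _ hne, fun x hx a ha => mem_sup_of_mem (Set.mem_biUnion hx ha), fun z hz => ?_⟩
  exact sup_le_iff.2 (Set.iUnion₂_subset fun x hx => hz hx)

/-- The zero of the cone `X_s` is the zero of `X`. -/
instance : Zero (SupCompletion X) := ⟨of 0⟩

/-- The addition of the cone `X_s`: `x + y = sup {a + b | a, b ∈ X, a ≤ x, b ≤ y}`. -/
instance : Add (SupCompletion X) :=
  ⟨fun x y => sup (Set.image2 (· + ·) x.carrier y.carrier) (x.nonempty'.image2 y.nonempty')⟩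

theorem add_le_iff {x y z : SupCompletion X} :
    x + y ≤ z ↔ ∀ a ∈ x.carrier, ∀ b ∈ y.carrier, a + b ∈ z.carrier :=
  sup_le_iff.trans Set.image2_subset_iff

theorem add_mem_add {x y : SupCompletion X} {a b : X} (ha : a ∈ x.carrier) (hb : b ∈ y.carrier) :
    a + b ∈ (x + y).carrier :=
  mem_sup_of_mem (Set.mem_image2_of_mem ha hb)

/-- The translate of an element of `X_s` by an element of `X`. -/
def translate (x : SupCompletion X) (c : X) : SupCompletion X where
  carrier := {a | a + c ∈ x.carrier}
  nonempty' := by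
    obtain ⟨a, ha⟩ := x.nonempty'
    exact ⟨a - c, by simpa using ha⟩
  closed' y hy := by
    refine x.closed' _ ⟨?_, fun u hu => ?_⟩
    · rintro _ ⟨b, -, rfl⟩; exact inf_le_left
    · refine le_sub_iff_add_le.1 (hy.2 ?_)
      rintro _ ⟨a, ha, rfl⟩
      have := hu ⟨a + c, ha, rfl⟩
      refine le_sub_iff_add_le.2 ?_
      simpa [inf_add] using this

theorem add_add_le_iff {x y w z : SupCompletion X} : x + y + w ≤ z ↔
    ∀ a ∈ x.carrier, ∀ b ∈ y.carrier, ∀ c ∈ w.carrier, a + b + c ∈ z.carrier := by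
  refine ⟨fun h a ha b hb c hc => h (add_mem_add (add_mem_add ha hb) hc), fun h => ?_⟩
  refine add_le_iff.2 fun d hd c hc => ?_
  have : x + y ≤ z.translate c := add_le_iff.2 fun a ha b hb => h a ha b hb c hc
  exact this hd

theorem add_comm_aux (x y : SupCompletion X) : x + y ≤ y + x :=
  add_le_iff.2 fun _ ha _ hb => add_comm (G := X) _ _ ▸ add_mem_add hb ha

theorem sup_add_sup_le {s t : Set X} {hs : s.Nonempty} {ht : t.Nonempty} {z : SupCompletion X}
    (h : ∀ a ∈ s, ∀ b ∈ t, a + b ∈ z.carrier) :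
    ∀ a ∈ (sup s hs).carrier, ∀ b ∈ (sup t ht).carrier, a + b ∈ z.carrier := by
  intro a ha b hb
  have h1 : sup s hs ≤ z.translate b := sup_le_iff.2 fun c hc => by
    have h2 : sup t ht ≤ z.translate c := sup_le_iff.2 fun d hd => by
      change d + c ∈ z.carrier
      rw [add_comm]; exact h c hc d hd
    have : b + c ∈ z.carrier := h2 hb
    change c + b ∈ z.carrier
    rwa [add_comm]
  exact h1 ha

instance : AddCommMonoid (SupCompletion X) where
  zero_add x := by
    refine le_antisymm (add_le_iff.2 fun a ha b hb => x.mem_of_le hb ?_) fun a ha => ?_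
    · exact add_le_of_nonpos_left ha
    · simpa using add_mem_add (x := (0 : SupCompletion X)) (le_refl (0 : X)) ha
  add_zero x := by
    refine le_antisymm (add_le_iff.2 fun a ha b hb => x.mem_of_le ha ?_) fun a ha => ?_
    · exact add_le_of_nonpos_right hb
    · simpa using add_mem_add (y := (0 : SupCompletion X)) ha (le_refl (0 : X))
  add_comm x y := le_antisymm (add_comm_aux x y) (add_comm_aux y x)
  add_assoc x y z := by
    refine le_antisymm (add_add_le_iff.2 fun a ha b hb c hc => ?_) ?_
    · rw [add_assoc]; exact add_mem_add ha (add_mem_add hb hc)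
    · refine (add_comm_aux _ _).trans (add_add_le_iff.2 fun b hb c hc a ha => ?_)
      have : b + c + a = a + b + c := by abel
      rw [this]; exact add_mem_add (add_mem_add ha hb) hc
  nsmul := nsmulRec

theorem of_add (a b : X) : of (a + b) = of a + of b :=
  le_antisymm (of_le_iff.2 (add_mem_add le_rfl le_rfl))
    (add_le_iff.2 fun _ hc _ hd => add_le_add (Set.mem_Iic.1 hc) (Set.mem_Iic.1 hd))

/-- In the order complete case, `X` is the set of invertible elements of `X_s`. -/
theorem isAddUnit_iff (hX : IsOrderComplete X) (x : SupCompletion X) :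
    IsAddUnit x ↔ ∃ a, x = of a := by
  constructor
  · rintro ⟨u, rfl⟩
    obtain ⟨b, hb⟩ := (u.neg : SupCompletion X).nonempty'
    have h : (u : SupCompletion X) + u.neg ≤ of 0 := u.val_neg.le
    refine exists_eq_of_of_le hX (b := -b) fun a ha => ?_
    exact le_neg_iff_add_nonpos_right.2 (add_le_iff.1 h a ha b hb)
  · rintro ⟨a, rfl⟩
    exact ⟨⟨of a, of (-a), by rw [← of_add, add_neg_cancel]; rfl,
      by rw [← of_add, neg_add_cancel]; rfl⟩, rfl⟩

/-- Distributivity of addition over the infimum with an element of `X`. -/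
theorem add_of_inf (x y : SupCompletion X) (f : X) : x + of f ⊓ y = (x + of f) ⊓ (x + y) := by
  refine le_antisymm (add_le_iff.2 fun a ha b hb => ⟨add_mem_add ha hb.1, add_mem_add ha hb.2⟩) ?_
  rintro c ⟨hc, hc'⟩
  have h1 : c - f ∈ x.carrier := by
    have : x + of f ≤ x.translate (-f) := add_le_iff.2 fun a ha b hb => by
      refine x.mem_of_le ha ?_
      rw [add_assoc]
      exact add_le_of_nonpos_right (by simpa using Set.mem_Iic.1 hb)
    rw [sub_eq_add_neg]; exact this hc
  refine closed' _ c ⟨?_, fun u hu => hc'.2 ?_⟩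
  · rintro _ ⟨b, -, rfl⟩; exact inf_le_left
  rintro _ ⟨_, ⟨a, ha, b, hb, rfl⟩, rfl⟩
  have h2 : (a ⊔ (c - f)) + f ⊓ b ∈ (x + of f ⊓ y).carrier :=
    add_mem_add (x.sup_mem ha h1) ⟨inf_le_left, y.mem_of_le hb inf_le_right⟩
  refine le_trans (le_inf inf_le_left ?_) (hu ⟨_, h2, rfl⟩)
  rw [add_inf]
  exact inf_le_inf (sub_le_iff_le_add.1 le_sup_right) (add_le_add_left le_sup_left b)

/-- Infinite distributivity: `x ⊓ sup A = sup {x ⊓ a | a ∈ A}` in `X_s`. -/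
theorem isLUB_inf {A : Set (SupCompletion X)} (hA : A.Nonempty) {m : SupCompletion X}
    (hm : IsLUB A m) (x : SupCompletion X) : IsLUB ((fun a => x ⊓ a) '' A) (x ⊓ m) := by
  refine ⟨?_, fun z hz => ?_⟩
  · rintro _ ⟨a, ha, rfl⟩; exact inf_le_inf_left x (hm.1 ha)
  have hne : (⋃ a ∈ A, a.carrier).Nonempty := by
    obtain ⟨a, ha⟩ := hA
    obtain ⟨b, hb⟩ := a.nonempty'
    exact ⟨b, Set.mem_biUnion ha hb⟩
  have h : m ≤ sup _ hne := hm.2 fun a ha b hb => mem_sup_of_mem (Set.mem_biUnion ha hb)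
  rintro c ⟨hcx, hcm⟩
  refine z.closed' c ⟨?_, fun u hu => (h hcm).2 ?_⟩
  · rintro _ ⟨b, -, rfl⟩; exact inf_le_left
  rintro _ ⟨b, hb, rfl⟩
  obtain ⟨a, ha, hba⟩ := Set.mem_iUnion₂.1 hb
  have : c ⊓ b ∈ z.carrier := hz ⟨a, ha, rfl⟩
    ⟨x.mem_of_le hcx inf_le_left, a.mem_of_le hba inf_le_right⟩
  simpa using hu ⟨_, this, rfl⟩

end Cone

section Module

variable {X : Type*} [AddCommGroup X] [Lattice X] [IsOrderedAddMonoid X] [Module ℝ X]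

/-- Multiplication of elements of the cone `X_s` by non-negative reals:
`r • x = sup {r • a | a ∈ X, a ≤ x}`. -/
instance : SMul ℝ≥0 (SupCompletion X) :=
  ⟨fun r x => sup ((fun a => (r : ℝ) • a) '' x.carrier) (x.nonempty'.image _)⟩

theorem smul_le_iff {r : ℝ≥0} {x z : SupCompletion X} :
    r • x ≤ z ↔ ∀ a ∈ x.carrier, (r : ℝ) • a ∈ z.carrier :=
  sup_le_iff.trans Set.image_subset_iff

theorem smul_mem_smul {r : ℝ≥0} {x : SupCompletion X} {a : X} (ha : a ∈ x.carrier) :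
    (r : ℝ) • a ∈ (r • x).carrier :=
  mem_sup_of_mem (Set.mem_image_of_mem _ ha)

variable [IsOrderedModule ℝ X]

/-- The multiple of an element of `X_s` by `r⁻¹` for `r > 0`, through the elements below it. -/
def pull (r : ℝ) (hr : 0 < r) (x : SupCompletion X) : SupCompletion X where
  carrier := {a | r • a ∈ x.carrier}
  nonempty' := by
    obtain ⟨a, ha⟩ := x.nonempty'
    exact ⟨r⁻¹ • a, by simpa [smul_smul, hr.ne'] using ha⟩
  closed' y hy := by
    refine x.closed' _ ⟨?_, fun u hu => ?_⟩
    · rintro _ ⟨b, -, rfl⟩; exact inf_le_left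
    · refine (le_inv_smul_iff_of_pos hr).1 (hy.2 ?_)
      rintro _ ⟨a, ha, rfl⟩
      refine (le_inv_smul_iff_of_pos hr).2 (le_trans ?_ (hu ⟨r • a, ha, rfl⟩))
      exact le_inf (smul_le_smul_of_nonneg_left inf_le_left hr.le)
        (smul_le_smul_of_nonneg_left inf_le_right hr.le)

theorem smul_of (r : ℝ≥0) (a : X) : r • of a = of ((r : ℝ) • a) :=
  le_antisymm (smul_le_iff.2 fun _ hb => smul_le_smul_of_nonneg_left (Set.mem_Iic.1 hb) r.2)
    (of_le_iff.2 (smul_mem_smul le_rfl))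

theorem zero_smul_aux (x : SupCompletion X) : (0 : ℝ≥0) • x = 0 := by
  obtain ⟨a, ha⟩ := x.nonempty'
  refine le_antisymm (smul_le_iff.2 fun b _ => ?_) (of_le_iff.2 ?_)
  · rw [NNReal.coe_zero, zero_smul]; exact le_refl (0 : X)
  · simpa using smul_mem_smul (r := 0) ha

/-- `X_s` is a cone. -/
instance : Module ℝ≥0 (SupCompletion X) where
  one_smul x := le_antisymm (smul_le_iff.2 fun a ha => by simpa using ha)
    fun a ha => by simpa using smul_mem_smul (r := 1) ha
  mul_smul r s x := by
    rcases eq_zero_or_pos r with rfl | hr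
    · rw [zero_mul, zero_smul_aux, zero_smul_aux]
    refine le_antisymm (smul_le_iff.2 fun a ha => ?_) (smul_le_iff.2 ?_)
    · rw [NNReal.coe_mul, mul_smul]; exact smul_mem_smul (smul_mem_smul ha)
    · have h : s • x ≤ pull (r : ℝ) hr ((r * s) • x) := smul_le_iff.2 fun a ha => by
        have := smul_mem_smul (r := r * s) ha
        rwa [NNReal.coe_mul, mul_smul] at this
      exact fun b hb => h hb
  smul_zero r := by rw [show (0 : SupCompletion X) = of 0 from rfl, smul_of, smul_zero]
  smul_add r x y := by
    rcases eq_zero_or_pos r with rfl | hr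
    · simp only [zero_smul_aux, add_zero]
    refine le_antisymm (smul_le_iff.2 ?_) (add_le_iff.2 ?_)
    · have h : x + y ≤ pull (r : ℝ) hr (r • x + r • y) := add_le_iff.2 fun a ha b hb => by
        have := add_mem_add (smul_mem_smul (r := r) ha) (smul_mem_smul (r := r) hb)
        rwa [← smul_add] at this
      exact fun b hb => h hb
    · refine sup_add_sup_le ?_
      rintro _ ⟨a, ha, rfl⟩ _ ⟨b, hb, rfl⟩
      have := smul_mem_smul (r := r) (add_mem_add ha hb)
      rwa [smul_add] at this
  add_smul r s x := by
    refine le_antisymm (smul_le_iff.2 fun a ha => ?_) ?_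
    · rw [NNReal.coe_add, add_smul]; exact add_mem_add (smul_mem_smul ha) (smul_mem_smul ha)
    · refine add_le_iff.2 (sup_add_sup_le ?_)
      rintro _ ⟨a, ha, rfl⟩ _ ⟨b, hb, rfl⟩
      have := smul_mem_smul (r := r + s) (x.sup_mem ha hb)
      rw [NNReal.coe_add, add_smul] at this
      exact mem_of_le _ this (add_le_add (smul_le_smul_of_nonneg_left le_sup_left r.2)
        (smul_le_smul_of_nonneg_left le_sup_right s.2))
  zero_smul := zero_smul_aux

end Module

/-- The elements of `X_s` that lie in the universal completion `X^u`, given by `j : X → X^u`. Every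
`x ∈ X_s` is the supremum of the elements of `X` below it, and so is every `u ∈ X^u` that has
elements of `X` below it (for instance, every `u ≥ 0`); `x` and `u` are identified if the same
elements of `X` are below `x` in `X_s` and below `u` in `X^u`. -/
def inUniversalCompletion {X U : Type*} [AddCommGroup X] [Lattice X] [Module ℝ X]
    [AddCommGroup U] [Lattice U] [Module ℝ U] (j : X →ₗ[ℝ] U) : Set (SupCompletion X) :=
  {x | ∃ u : U, ∀ y : X, of y ≤ x ↔ j y ≤ u}

end SupCompletion

/-! The contrapositive is local boundedness. Suppose no `d > 0` in `D` has all its multiples below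
`x`. If `n • d` is not below `x`, then on some non-zero band inside that of `d` every `c ≤ x` is at
most `n • d` (`exists_pos_forall_inf_eq_zero`), so the bands on which `x` is bounded are order
dense. By Zorn's lemma there is a maximal disjoint family of generators `r` of such bands. Cutting
each bound down to the band of its `r` gives pairwise disjoint `p r`, and lateral completeness of
`U` glues them to one upper bound `v` of `x` (`bddAbove_of_forall_exists_nsmul_notMem`). An `x`
bounded in `U` is identified with its supremum there, so it lies in `X^u`. Hence, if `x` is not in
`X^u`, some `d > 0` has all its multiples below `x`, and density of `X` in `D` gives `0 < a ≤ d`. -/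

section InfAdd

variable {Y : Type*} [AddCommGroup Y] [Lattice Y] [IsOrderedAddMonoid Y]

/-- The right side is the infimum of the four sums `a + b`, `s + b`, `a + s`, `s + s`, and the last
three are at least `s`. -/
theorem add_inf_le_inf_add_inf {a b s : Y} (ha : 0 ≤ a) (hb : 0 ≤ b) (hs : 0 ≤ s) :
    (a + b) ⊓ s ≤ a ⊓ s + b ⊓ s := by
  rw [add_inf, inf_add, inf_add]
  refine le_inf (le_inf inf_le_left ?_) (le_inf ?_ ?_)
  · exact inf_le_right.trans (le_add_of_nonneg_right hb)
  · exact inf_le_right.trans (le_add_of_nonneg_left ha)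
  · exact inf_le_right.trans (le_add_of_nonneg_left hs)

theorem nsmul_inf_eq_zero {a s : Y} (ha : 0 ≤ a) (hs : 0 ≤ s) (h : a ⊓ s = 0) (n : ℕ) :
    (n • a) ⊓ s = 0 := by
  induction n with
  | zero => simpa using hs
  | succ n ih =>
    refine le_antisymm ?_ (le_inf (nsmul_nonneg ha _) hs)
    rw [succ_nsmul]
    simpa [ih, h] using add_inf_le_inf_add_inf (nsmul_nonneg ha n) ha hs

end InfAdd

/-! ### Maximal disjoint sets and components in principal bands. -/

section Disjointness

variable {Y : Type*} [AddCommGroup Y] [Lattice Y]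

/-- Every order dense set `G` of positive elements contains a maximal disjoint set, and the latter
is disjoint from no positive element. -/
theorem exists_pairwise_disjoint_of_dense {G : Set Y} (hG : ∀ d, 0 < d → ∃ r ∈ G, 0 < r ∧ r ≤ d) :
    ∃ S ⊆ G, (S.Pairwise fun a b => a ⊓ b = 0) ∧
      ∀ d, 0 < d → (∀ r ∈ S, 0 ≤ r) → ∃ r ∈ S, 0 < d ⊓ r := by
  obtain ⟨S, hS⟩ := zorn_subset {S : Set Y | S ⊆ G ∧ S.Pairwise fun a b => a ⊓ b = 0}
    fun c hc hchain => ⟨⋃₀ c, ⟨Set.sUnion_subset fun s hs => (hc hs).1,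
      (Set.pairwise_sUnion hchain.directedOn).2 fun s hs => (hc hs).2⟩,
      fun s hs => Set.subset_sUnion_of_mem hs⟩
  refine ⟨S, hS.prop.1, hS.prop.2, fun d hd hS0 => ?_⟩
  by_contra! hcon
  have hdis : ∀ r ∈ S, d ⊓ r = 0 := fun r hr =>
    ((le_inf hd.le (hS0 r hr)).eq_or_lt.resolve_right (hcon r hr)).symm
  obtain ⟨g, hgG, hg, hgd⟩ := hG d hd
  have hgdis : ∀ r ∈ S, g ⊓ r = 0 := fun r hr =>
    le_antisymm ((inf_le_inf_right r hgd).trans (hdis r hr).le) (le_inf hg.le (hS0 r hr))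
  -- Maximality forces `g` into `S`, so `g` is disjoint from itself.
  have hgS : g ∈ S := hS.le_of_ge (y := insert g S)
    ⟨Set.insert_subset hgG hS.prop.1, hS.prop.2.insert fun r hr _ =>
      ⟨hgdis r hr, by rw [inf_comm]; exact hgdis r hr⟩⟩ (Set.subset_insert g S)
    (Set.mem_insert g S)
  exact hg.ne' (by simpa using hgdis g hgS)

/-- `p` is the component of `b` in the principal band generated by `r`. -/
def IsBandComponent (r b p : Y) : Prop :=
  IsLUB (Set.range fun n : ℕ => b ⊓ n • r) p

theorem IsOrderComplete.exists_isBandComponent (hY : IsOrderComplete Y) (r b : Y) :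
    ∃ p, IsBandComponent r b p :=
  hY _ (Set.range_nonempty _) ⟨b, by rintro _ ⟨n, rfl⟩; exact inf_le_left⟩

namespace IsBandComponent

variable {r b p : Y}

theorem le (h : IsBandComponent r b p) : p ≤ b :=
  h.2 (by rintro _ ⟨n, rfl⟩; exact inf_le_left)

theorem nonneg (h : IsBandComponent r b p) (hb : 0 ≤ b) : 0 ≤ p := by
  simpa [hb] using h.1 ⟨0, rfl⟩

variable [IsOrderedAddMonoid Y]

/-- Adding `(b - p) ⊓ r` to `b ⊓ n • r` stays below `b ⊓ (n + 1) • r`, hence below `p`. So `p - (b -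
p) ⊓ r` is still an upper bound, and `p` is the least one. -/
theorem sub_inf_eq_zero (h : IsBandComponent r b p) (hr : 0 ≤ r) : (b - p) ⊓ r = 0 := by
  refine le_antisymm ?_ (le_inf (sub_nonneg.2 h.le) hr)
  have key : p ≤ p - (b - p) ⊓ r := h.2 <| by
    rintro _ ⟨n, rfl⟩
    refine le_sub_iff_add_le.2 (le_trans (le_inf ?_ ?_) (h.1 ⟨n + 1, rfl⟩))
    · calc b ⊓ n • r + (b - p) ⊓ r ≤ p + (b - p) := add_le_add (h.1 ⟨n, rfl⟩) inf_le_left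
        _ = b := by abel
    · rw [succ_nsmul]
      exact add_le_add inf_le_right inf_le_right
  simpa using key

/-- Disjointness from `s` passes from `r` to its multiples, and then to the supremum `p` by infinite
distributivity. -/
theorem inf_eq_zero (h : IsBandComponent r b p) (hr : 0 ≤ r) (hb : 0 ≤ b) {s : Y} (hs : 0 ≤ s)
    (hrs : r ⊓ s = 0) : p ⊓ s = 0 := by
  refine le_antisymm ?_ (le_inf (h.nonneg hb) hs)
  rw [inf_comm]
  refine SupCompletion.inf_le_of_isLUB h ?_
  rintro _ ⟨n, rfl⟩
  calc s ⊓ (b ⊓ n • r) ≤ n • r ⊓ s := le_inf (inf_le_right.trans inf_le_right) inf_le_left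
    _ ≤ 0 := (nsmul_inf_eq_zero hr hs hrs n).le

/-- If `c` is at most `b` on the band generated by `r`, then it is at most `p` there. -/
theorem pos_sub_inf_eq_zero (h : IsBandComponent r b p) (hr : 0 ≤ r) {c : Y}
    (hc : ((c - b) ⊔ 0) ⊓ r = 0) : ((c - p) ⊔ 0) ⊓ r = 0 := by
  refine le_antisymm ?_ (le_inf le_sup_right hr)
  have hbp : 0 ≤ b - p := sub_nonneg.2 h.le
  -- Replacing `b` by `p` raises the excess by at most `b - p`, which is disjoint from `r`.
  have h1 : (c - p) ⊔ 0 ≤ ((c - b) ⊔ 0) + (b - p) := by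
    refine sup_le ?_ (add_nonneg le_sup_right hbp)
    calc c - p = (c - b) + (b - p) := by abel
      _ ≤ _ := by gcongr; exact le_sup_left
  refine (inf_le_inf_right r h1).trans ((add_inf_le_inf_add_inf le_sup_right hbp hr).trans ?_)
  rw [hc, h.sub_inf_eq_zero hr, add_zero]

end IsBandComponent

end Disjointness

theorem IsOrderDenseEmbedding.le_iff {X Y : Type*} [AddCommGroup X] [Lattice X] [Module ℝ X]
    [AddCommGroup Y] [Lattice Y] [Module ℝ Y] {f : X →ₗ[ℝ] Y} (hf : IsOrderDenseEmbedding f)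
    {a b : X} : f a ≤ f b ↔ a ≤ b := by
  rw [← inf_eq_left, ← hf.map_inf, hf.injective.eq_iff, inf_eq_left]

/-! ### Boundedness in the universal completion. -/

namespace SupCompletion

variable {D U : Type*} [AddCommGroup D] [Lattice D]
  [AddCommGroup U] [Lattice U] [IsOrderedAddMonoid U] [Module ℝ U]

/-- An element of the sup-completion whose set of lower elements is bounded above in the universal
completion lies in the universal completion. -/
theorem mem_inUniversalCompletion_of_bddAbove [Module ℝ D] {j : D →ₗ[ℝ] U}
    (hj : IsUniversalCompletion j) (x : SupCompletion D) (h : BddAbove (j '' x.carrier)) : x ∈ inUniversalCompletion j := by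
  obtain ⟨u, hu⟩ := hj.orderComplete _ (x.nonempty'.image j) h
  refine ⟨u, fun y => of_le_iff.trans ⟨fun hy => hu.1 ⟨y, hy, rfl⟩, fun hy => ?_⟩⟩
  refine x.closed' y ⟨by rintro _ ⟨b, -, rfl⟩; exact inf_le_left, fun v hv => ?_⟩
  -- Since `j y = j y ⊓ u` and `u` is a supremum, distributivity reduces the claim to `j y ⊓ j c ≤ j
  -- v` for `c` below `x`.
  rw [← hj.le_iff, ← inf_eq_left.2 hy]
  refine inf_le_of_isLUB hu ?_
  rintro _ ⟨c, hc, rfl⟩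
  rw [← hj.map_inf, hj.le_iff]
  exact hv ⟨c, hc, rfl⟩

variable [IsOrderedAddMonoid D]

/-- If `n • d` is not below `x`, then `x` is at most `n • d` on a non-zero band inside the one
generated by `d`. -/
theorem exists_pos_forall_inf_eq_zero (hD : IsOrderComplete D) {x : SupCompletion D}
    (hx : 0 ≤ x) {d : D} (hd : 0 < d) {n : ℕ} (hn : n • d ∉ x.carrier) :
    ∃ r, 0 < r ∧ r ≤ d ∧ ∀ c ∈ x.carrier, ((c - n • d) ⊔ 0) ⊓ r = 0 := by
  have hnd : 0 ≤ n • d := nsmul_nonneg hd.le n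
  -- `w` is the part of `n • d` below `x`. The remainder `n • d - w` is non-zero and generates the
  -- band where `x` is at most `n • d`.
  obtain ⟨w, hw⟩ := hD ((fun c => n • d ⊓ c) '' x.carrier) (x.nonempty'.image _)
    ⟨n • d, by rintro _ ⟨c, -, rfl⟩; exact inf_le_left⟩
  have hwle : w ≤ n • d := hw.2 (by rintro _ ⟨c, -, rfl⟩; exact inf_le_left)
  have hwne : w ≠ n • d := by
    rintro rfl
    exact hn (x.closed' _ hw)
  have hpos : 0 < n • d - w := sub_pos.2 (lt_of_le_of_ne hwle hwne)
  have hw0 : 0 ≤ w := by simpa [hnd] using hw.1 ⟨0, of_le_iff.1 hx, rfl⟩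
  have hdis : ∀ c ∈ x.carrier, ((c - n • d) ⊔ 0) ⊓ (n • d - w) ≤ 0 := fun c hc => by
    -- The right side is the positive part of `n • d - c`, which is disjoint from that of `c - n •
    -- d`.
    have h1 : n • d - w ≤ n • d - n • d ⊓ c := sub_le_sub_left (hw.1 ⟨c, hc, rfl⟩) _
    refine (inf_le_inf_left _ h1).trans (le_of_eq ?_)
    have h2 : (c - n • d) ⊔ 0 = c - n • d ⊓ c := by
      rw [sub_eq_add_neg c (n • d ⊓ c), neg_inf, add_sup]; simp [sub_eq_add_neg]
    rw [h2, sub_eq_add_neg, sub_eq_add_neg, ← inf_add, inf_comm, add_neg_cancel]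
  have hrd : 0 ≤ (n • d - w) ⊓ d := le_inf hpos.le hd.le
  refine ⟨(n • d - w) ⊓ d, hrd.lt_of_ne fun h0 => ?_, inf_le_right, fun c hc => ?_⟩
  · -- otherwise `n • d - w` would be disjoint from `d`, hence from `n • d`; but `w ≥ 0`
    have h1 : n • d ⊓ (n • d - w) = 0 :=
      nsmul_inf_eq_zero hd.le hpos.le (by rw [inf_comm, ← h0]) n
    rw [inf_eq_right.2 (sub_le_self _ hw0)] at h1
    exact hpos.ne' h1
  · exact le_antisymm ((inf_le_inf_left _ inf_le_left).trans (hdis c hc)) (le_inf le_sup_right hrd)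

/-- If no `d > 0` has all its multiples below `x ≥ 0`, then `x` is bounded above in the universal
completion. -/
theorem bddAbove_of_forall_exists_nsmul_notMem [Module ℝ D] (hD : IsOrderComplete D) {j : D →ₗ[ℝ] U}
    (hj : IsUniversalCompletion j) {x : SupCompletion D} (hx : 0 ≤ x)
    (h : ∀ d, 0 < d → ∃ n : ℕ, n • d ∉ x.carrier) : BddAbove (j '' x.carrier) := by
  obtain ⟨S, hSG, hSdis, hSmax⟩ := exists_pairwise_disjoint_of_dense
    (G := {r : D | 0 < r ∧ ∃ b, 0 ≤ b ∧ ∀ c ∈ x.carrier, ((c - b) ⊔ 0) ⊓ r = 0}) fun d hd => by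
      obtain ⟨n, hn⟩ := h d hd
      obtain ⟨r, hr, hrd, hrx⟩ := exists_pos_forall_inf_eq_zero hD hx hd hn
      exact ⟨r, ⟨hr, n • d, nsmul_nonneg hd.le n, hrx⟩, hr, hrd⟩
  have hS0 : ∀ r ∈ S, 0 ≤ r := fun r hr => (hSG hr).1.le
  -- The bounds `b` for different `r` may overlap. Their components `p` in the bands of the `r`
  -- bound `x` there equally well and are pairwise disjoint.
  have hp : ∀ r : D, ∃ p : D, r ∈ S → 0 ≤ p ∧ (∀ s, 0 ≤ s → r ⊓ s = 0 → p ⊓ s = 0) ∧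
      ∀ c ∈ x.carrier, ((c - p) ⊔ 0) ⊓ r = 0 := fun r => by
    by_cases hr : r ∈ S
    · obtain ⟨b, hb, hbx⟩ := (hSG hr).2
      obtain ⟨p, hp⟩ := hD.exists_isBandComponent r b
      exact ⟨p, fun _ => ⟨hp.nonneg hb, fun s hs hrs => hp.inf_eq_zero (hS0 r hr) hb hs hrs,
        fun c hc => hp.pos_sub_inf_eq_zero (hS0 r hr) (hbx c hc)⟩⟩
    · exact ⟨0, fun hr' => absurd hr' hr⟩
  choose p hp using hp
  have hj0 : ∀ {a : D}, 0 ≤ a → 0 ≤ j a := fun ha => by rwa [← map_zero j, hj.le_iff]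
  -- zero is inserted since `S` is empty if `D` is trivial
  obtain ⟨v, hv⟩ := hj.laterallyComplete (insert 0 ((fun r => j (p r)) '' S))
    (Set.insert_nonempty _ _)
    (by
      rintro _ (rfl | ⟨r, hr, rfl⟩)
      · exact le_rfl
      · exact hj0 (hp r hr).1)
    (by
      refine Set.Pairwise.insert ?_ ?_
      · rintro _ ⟨r, hr, rfl⟩ _ ⟨s, hs, rfl⟩ hne
        have hrs : r ≠ s := fun h => hne (by rw [h])
        have h1 : p r ⊓ s = 0 := (hp r hr).2.1 s (hS0 s hs) (hSdis hr hs hrs)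
        -- The disjointness property of `p` is applied twice: `r ⊥ s` gives `p r ⊥ s`, which gives
        -- `p s ⊥ p r`.
        have h2 : p s ⊓ p r = 0 := (hp s hs).2.1 _ (hp r hr).1 (by rw [inf_comm, h1])
        change j (p r) ⊓ j (p s) = 0
        rw [← hj.map_inf, inf_comm, h2, map_zero]
      · rintro _ ⟨r, hr, rfl⟩ -
        have := hj0 (hp r hr).1
        exact ⟨inf_eq_left.2 this, inf_eq_right.2 this⟩)
  refine ⟨v, ?_⟩
  rintro _ ⟨c, hc, rfl⟩
  by_contra hcv
  have hpos : 0 < (j c - v) ⊔ 0 := le_sup_right.lt_of_ne fun h0 =>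
    hcv (sub_nonpos.1 (le_sup_left.trans h0.ge))
  -- An excess of `j c` over `v` would dominate some `d > 0` of `D`, and `d` meets some `r` in `S`.
  -- As `v ≥ j (p r)`, `d` is below the excess of `c` over `p r`, which is disjoint from `r`.
  obtain ⟨d, hd, hdle⟩ := hj.dense _ hpos
  obtain ⟨r, hr, hdr⟩ := hSmax d hd hS0
  refine hdr.not_ge (le_trans (inf_le_inf_right r ?_) ((hp r hr).2.2 c hc).le)
  rw [← hj.le_iff, hj.map_sup, map_sub, map_zero]
  exact hdle.trans (sup_le_sup_right
    (sub_le_sub_left (hv.1 (Set.mem_insert_of_mem _ ⟨r, hr, rfl⟩)) _) _)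

end SupCompletion

theorem corollary2p10 {X D U : Type*}
    [AddCommGroup X] [Lattice X] [IsOrderedAddMonoid X] [Module ℝ X] [IsOrderedModule ℝ X]
    [AddCommGroup D] [Lattice D] [IsOrderedAddMonoid D] [Module ℝ D] [IsOrderedModule ℝ D]
    [AddCommGroup U] [Lattice U] [IsOrderedAddMonoid U] [Module ℝ U] [IsOrderedModule ℝ U]
    (i : X →ₗ[ℝ] D) (hi : IsOrderCompletion i)
    (j : D →ₗ[ℝ] U) (hj : IsUniversalCompletion j)
    (x : SupCompletion D) (hx0 : 0 ≤ x) (hx : x ∉ SupCompletion.inUniversalCompletion j) :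
    ∃ a : X, ∀ t : ℝ, 0 < t → SupCompletion.of (i (t • a)) ≤ x ∧ 0 < t • a := by
  have hd : ∃ d : D, 0 < d ∧ ∀ n : ℕ, n • d ∈ x.carrier := by
    by_contra! hcon
    exact hx (x.mem_inUniversalCompletion_of_bddAbove hj
      (SupCompletion.bddAbove_of_forall_exists_nsmul_notMem hi.orderComplete hj hx0 hcon))
  obtain ⟨d, hd, hdx⟩ := hd
  obtain ⟨a, ha, had⟩ := hi.dense d hd
  refine ⟨a, fun t ht => ⟨SupCompletion.of_le_iff.2 ?_,
    (smul_nonneg ht.le ha.le).lt_of_ne' (smul_ne_zero ht.ne' ha.ne')⟩⟩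
  -- The natural multiples of `d` dominate all positive real multiples of `i a`.
  obtain ⟨n, hn⟩ := exists_nat_ge t
  refine x.mem_of_le (hdx n) ?_
  rw [map_smul]
  calc t • i a ≤ t • d := smul_le_smul_of_nonneg_left had ht.le
    _ ≤ (n : ℝ) • d := smul_le_smul_of_nonneg_right hn hd.le
    _ = n • d := Nat.cast_smul_eq_nsmul ℝ n d
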